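/- Let $n,k,d,e$ be integers with $k,e\ge 1$ and $k\le d\le n-e$. A file is stored on $n$ nodes. A centralized multi-node repair code with parameters $(M,n,k,d,e,\alpha,\beta)$, operated for at most $T$ repair rounds, stores a file of size $M$ on the $n$ nodes, each of which holds an amount $\alpha$ of information, so that the following holds. At any time the contents of any $k$ nodes determine the file. In each repair round an arbitrary set of $e$ nodes fails; a central node downloads from each node of an arbitrary set of $d$ surviving nodes an amount $\beta$ of information, computed from the content of that node alone, and computes from the $d$ downloads the contents of the $e$ replacement nodes. These need not equal the lost contents (functional repair), but the file must remain reconstructible from any $k$ nodes initially and after each round, for every sequence of at most $T$ rounds of failure sets and helper sets; each repair may depend on the rounds up to the present one, not on future ones. For $\mathbf u$ in the set $\mathcal P=\{(u_1,\dots,u_g): g\in\mathbb N,\ 1\le u_i\le e,\ \sum_{i=1}^g u_i=k\}$ put $$f(\mathbf u)=\sum_{i=1}^{g}\min\Bigl(u_i\alpha,\ \bigl(d-\sum_{j=1}^{i-1}u_j\bigr)\beta\Bigr).$$ Let the number of repair rounds be bounded by an arbitrary integer $T\ge k$. Then codes with parameters $(M,n,k,d,e,\alpha,\beta)$ for at most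 $T$ repair rounds exist if and only if $$M\le\min_{\mathbf u\in\mathcal P}f(\mathbf u).$$ This holds in both of the following senses. (i) $M,\alpha,\beta$ are non-negative integers, counting symbols of a common finite alphabet with at least two elements, and existence means that for some such alphabet there is a code whose file consists of $M$ symbols, whose nodes store $\alpha$ symbols each, and whose helpers send $\beta$ symbols each. (ii) $M,\alpha,\beta$ are non-negative real numbers, and existence means that for every $\varepsilon>0$ there are $r>0$, finite sets $F$ (files), $A$ (node contents), $B$ (messages of a helper) with $\log|F|\ge r(M-\varepsilon)$, $\log|A|\le r\alpha$, $\log|B|\le r\beta$, and a code over these sets. -/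

import Mathlib

namespace CentralizedRepair

section Scenarios

/-- The set of recovery scenarios: compositions of `k` whose parts lie between `1` and `e`
(parts of a `Composition` are positive). -/
def scenarios (k e : ℕ) : Finset (Composition k) :=
  Finset.univ.filter fun u => ∀ b ∈ u.blocks, b ≤ e

theorem scenarios_nonempty (k : ℕ) {e : ℕ} (he : 1 ≤ e) : (scenarios k e).Nonempty := by
  refine ⟨Composition.ones k, ?_⟩
  simp only [scenarios, Finset.mem_filter, Finset.mem_univ, true_and]
  intro b hb
  rw [Composition.ones_blocks] at hb
  rw [List.eq_of_mem_replicate hb]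
  exact he

/-- `f(u) = ∑ i, min (u_i α) ((d - ∑_{j < i} u_j) β)`;
`u.sizeUpTo i` is the sum of the parts of index smaller than `i`. -/
noncomputable def scenarioValue {k : ℕ} (d : ℕ) (α β : ℝ) (u : Composition k) : ℝ :=
  ∑ i : Fin u.length,
    min ((u.blocksFun i : ℝ) * α) (((d : ℝ) - (u.sizeUpTo i : ℝ)) * β)

/-- The minimum of `f(u)` over all recovery scenarios. -/
noncomputable def minScenarioValue (k d : ℕ) {e : ℕ} (he : 1 ≤ e) (α β : ℝ) : ℝ :=
  (scenarios k e).inf' (scenarios_nonempty k he) (scenarioValue d α β)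

end Scenarios

section Codes

/-- Reconstruction property. `F` is the set of files, `A` the set of possible contents of one node,
and `c i x` is the content of node `i` when the file is `x`. A data collector that reads any `k` of
the `n` nodes recovers the file. -/
def Reconstructs {n : ℕ} {F A : Type} (k : ℕ) (c : Fin n → F → A) : Prop :=
  ∀ K : Finset (Fin n), K.card = k →
    ∃ decode : (K → A) → F, ∀ x : F, decode (fun i => c i x) = x

/-- One centralized repair round turns the contents `c` into `c'`. The nodes of `E` have failed; each
helper `h ∈ H` sends to the central node one element of `B` computed from its own content; the
central node computes from these messages the contents of all the replacement nodes. The surviving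
nodes are unchanged. -/
def IsRepair {n : ℕ} {F A : Type} (B : Type) (E H : Finset (Fin n)) (c c' : Fin n → F → A) : Prop :=
  (∀ i, i ∉ E → c' i = c i) ∧
  ∃ (send : H → A → B) (central : (H → B) → (E → A)),
    ∀ (i : E) (x : F), c' i x = central (fun h => send h (c h x)) i

/-- The code with current contents `c` can be operated, under functional repair, through any `T`
further repair rounds. The file can be reconstructed now, and if `T > 0`, then for any set `E` of `e`
failed nodes and any set `H` of `d` helpers among the surviving nodes there is a repair round after
which the new contents can be operated through any `T - 1` further repair rounds. The repair may
depend on the failures and helpers up to now, and not on the later ones. -/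
def Survives {n : ℕ} {F A : Type} (B : Type) (k d e : ℕ) : ℕ → (Fin n → F → A) → Prop
  | 0, c => Reconstructs k c
  | T + 1, c => Reconstructs k c ∧
      ∀ E H : Finset (Fin n), E.card = e → H.card = d → Disjoint E H →
        ∃ c' : Fin n → F → A, IsRepair B E H c c' ∧ Survives B k d e T c'

/-- Centralized multi-node repair codes with parameters `(M, n, k, d, e, α, β)` exist, for at most
`T` repair rounds, where amounts of information are numbers of symbols of a common finite alphabet
`Q` with at least two elements: the file consists of `M` symbols, each node stores `α` symbols, and
each helper sends `β` symbols. -/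
def CodesExist (M n k d e α β T : ℕ) : Prop :=
  ∃ (Q : Type) (_ : Fintype Q) (_ : Nontrivial Q)
    (c : Fin n → (Fin M → Q) → (Fin α → Q)), Survives (Fin β → Q) k d e T c

/-- The same for real amounts of information. The amount of information that an element of a finite
set `X` carries is `log |X|`, in multiples of a unit `r > 0`. For irrational amounts the file size
`M` is required only up to an arbitrarily small error, as is usual for rates. -/
def CodesExistReal (M : ℝ) (n k d e : ℕ) (α β : ℝ) (T : ℕ) : Prop :=
  ∀ ε : ℝ, 0 < ε →
    ∃ (F A B : Type) (_ : Fintype F) (_ : Fintype A) (_ : Fintype B) (r : ℝ),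
      0 < r ∧
      r * (M - ε) ≤ Real.log (Fintype.card F) ∧
      Real.log (Fintype.card A) ≤ r * α ∧
      Real.log (Fintype.card B) ≤ r * β ∧
      ∃ c : Fin n → F → A, Survives B k d e T c

end Codes

end CentralizedRepair

/-!
The theorem is a cut-set bound together with a random linear code that meets it.

*The bound.* Given a composition `u` of `k`, the adversary fails disjoint sets `D₁, D₂, …` of sizes
`u₁, u₂, …` (and further nodes) in successive rounds, with all earlier sets among the helpers. In round `i` the
new contents of `D_i` are known from their own `u_i α` symbols, or from the messages of the
`d - (u₁ + ⋯ + u_{i-1})` helpers whose contents are not yet known. So the `k` nodes of the union are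
described by `f(u)` symbols, and they determine the file (`PartialValue.exists_describedBy`,
`Survives.log_card_le`). At most `k` rounds are needed, whence `k ≤ T`.

*The codes.* Files are vectors over a large prime field, and every node stores `α` linear functions of
the file. The invariant `RankBound` says that any `s ≤ k` nodes store at least `min M (f u)`
independent functions, for some composition `u` of `s` with parts at most `e`; for `s = k` it gives
reconstruction. It survives a repair in which the helpers send generic functions of their contents
and the new nodes store generic elements of the span of the messages. Rado's formula for the rank of
generic vectors (`exists_generic_vectors`) computes the rank of `S₀ ∪ S₁`, with `S₀` surviving and
`S₁` new: it is at least `rank S₀ + |S₁| α`, or at least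
`rank (S₀ ∪ R) + (d - |S₀| - |R|) β` for some set `R` of helpers outside `S₀`. In the first case the
part `|S₁|` is appended to the composition of `|S₀|`. In the second case the part `|S₁| - |R|` is
appended to that of `|S₀| + |R|`, and if `|R| ≥ |S₁|` the invariant for `|S₀| + |S₁|` old nodes
suffices (`RankBound.exists_repair`). The field size depends on `n`, `α` and `β` only, so the same
code survives any number of rounds.

Real parameters are reduced to integer ones by scaling and rounding down
(`PartialValue.exists_approx`).
-/

namespace CentralizedRepair

/-! ### Values of recovery scenarios -/

/-- `PartialValue d e α β s v` says that `v` is the value `f(u)` of some composition `u` of `s` with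
parts at most `e`. A composition is built by appending parts at its end, which is how both the
failure of further nodes and the induction over the terms of `f(u)` proceed. -/
inductive PartialValue (d e : ℕ) (α β : ℝ) : ℕ → ℝ → Prop
  | zero : PartialValue d e α β 0 0
  | append {s t : ℕ} {v : ℝ} : PartialValue d e α β s v → 1 ≤ t → t ≤ e →
      PartialValue d e α β (s + t) (v + min ((t : ℝ) * α) (((d : ℝ) - (s : ℝ)) * β))

theorem scenarioValue_eq_sum_range {s : ℕ} (d : ℕ) (α β : ℝ) (u : Composition s) :
    scenarioValue d α β u = ∑ i ∈ Finset.range u.blocks.length,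
      min ((u.blocks.getD i 0 : ℝ) * α) (((d : ℝ) - ((u.blocks.take i).sum : ℝ)) * β) := by
  rw [Finset.sum_range]
  unfold scenarioValue
  refine Finset.sum_congr rfl fun i _ => ?_
  simp [Composition.blocksFun, Composition.sizeUpTo]

theorem PartialValue.exists_scenario {d e s : ℕ} {α β v : ℝ} (h : PartialValue d e α β s v) :
    ∃ u ∈ scenarios s e, scenarioValue d α β u = v := by
  induction h with
  | zero => exact ⟨⟨[], by simp, by simp⟩, by simp [scenarios], by
      simp [scenarioValue_eq_sum_range]⟩
  | @append s t v _ ht hte ih =>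
    obtain ⟨u, hu, huv⟩ := ih
    refine ⟨⟨u.blocks ++ [t], ?_, ?_⟩, ?_, ?_⟩
    · intro i hi
      rcases List.mem_append.1 hi with hi | hi
      · exact u.blocks_pos hi
      · rw [List.mem_singleton.1 hi]; exact ht
    · simp [u.blocks_sum]
    · simp only [scenarios, Finset.mem_filter, Finset.mem_univ, true_and] at hu ⊢
      intro b hb
      rcases List.mem_append.1 hb with hb | hb
      · exact hu b hb
      · rw [List.mem_singleton.1 hb]; exact hte
    · rw [scenarioValue_eq_sum_range, List.length_append, List.length_singleton,
        Finset.sum_range_succ, ← huv, scenarioValue_eq_sum_range]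
      congr 1
      · refine Finset.sum_congr rfl fun i hi => ?_
        have hi := Finset.mem_range.1 hi
        rw [List.getD_append _ _ _ _ hi, List.take_append_of_le_length hi.le]
      · simp [u.blocks_sum]

theorem partialValue_scenarioValue {d e k : ℕ} {α β : ℝ} {u : Composition k}
    (hu : u ∈ scenarios k e) : PartialValue d e α β k (scenarioValue d α β u) := by
  simp only [scenarios, Finset.mem_filter, Finset.mem_univ, true_and] at hu
  have key : ∀ i ≤ u.blocks.length, PartialValue d e α β (u.blocks.take i).sum
      (∑ j ∈ Finset.range i, min ((u.blocks.getD j 0 : ℝ) * α)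
        (((d : ℝ) - ((u.blocks.take j).sum : ℝ)) * β)) := by
    intro i
    induction i with
    | zero => intro _; simpa using PartialValue.zero
    | succ i ih =>
      intro hi
      have hmem : u.blocks[i] ∈ u.blocks := List.getElem_mem _
      have := (ih (by omega)).append (u.one_le_blocks hmem) (hu _ hmem)
      rw [Finset.sum_range_succ, List.sum_take_succ _ _ hi, List.getD_eq_getElem _ _ hi]
      exact this
  have := key _ le_rfl
  rwa [← scenarioValue_eq_sum_range, List.take_length, u.blocks_sum] at this

theorem le_minScenarioValue_iff {k d e : ℕ} (he : 1 ≤ e) {α β M : ℝ} :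
    M ≤ minScenarioValue k d he α β ↔ ∀ v, PartialValue d e α β k v → M ≤ v := by
  rw [minScenarioValue, Finset.le_inf'_iff]
  constructor
  · intro h v hv
    obtain ⟨u, hu, rfl⟩ := hv.exists_scenario
    exact h u hu
  · exact fun h u hu => h _ (partialValue_scenarioValue hu)

theorem PartialValue.nonneg {d e s : ℕ} {α β v : ℝ} (hα : 0 ≤ α) (hβ : 0 ≤ β) (hs : s ≤ d)
    (h : PartialValue d e α β s v) : 0 ≤ v := by
  induction h with
  | zero => exact le_rfl
  | @append s t v _ _ _ ih =>
    have hsd : (0 : ℝ) ≤ (d : ℝ) - s := by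
      rw [sub_nonneg]; exact_mod_cast (by omega : s ≤ d)
    exact add_nonneg (ih (by omega)) (le_min (by positivity) (by positivity))

theorem PartialValue.le_mul {d e s : ℕ} {α β v : ℝ} (h : PartialValue d e α β s v) :
    v ≤ s * α := by
  induction h with
  | zero => simp
  | @append s t v _ _ _ ih =>
    push_cast
    linarith [min_le_left ((t : ℝ) * α) (((d : ℝ) - (s : ℝ)) * β)]

theorem exists_partialValue {d e : ℕ} (he : 1 ≤ e) (α β : ℝ) (s : ℕ) :
    ∃ v, PartialValue d e α β s v := by
  obtain ⟨u, hu⟩ := scenarios_nonempty s he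
  exact ⟨_, partialValue_scenarioValue hu⟩

/-- Every term of `f` is homogeneous of degree one in `(α, β)` and increasing in both. Lowering the
scaled parameters by at most `δ` lowers each of the at most `s` terms by at most `d * δ`. -/
theorem PartialValue.exists_approx {d e s : ℕ} {α β α' β' L δ v : ℝ} (hL : 0 ≤ L)
    (hδ : 0 ≤ δ) (hα : L * α - δ ≤ α') (hβ : L * β - δ ≤ β') (hs : s ≤ d)
    (h : PartialValue d e α' β' s v) :
    ∃ w, PartialValue d e α β s w ∧ L * w - s * (d * δ) ≤ v := by
  induction h with
  | zero => exact ⟨0, .zero, by simp⟩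
  | @append s t v hv ht hte ih =>
    obtain ⟨w, hw, hwv⟩ := ih (by omega)
    refine ⟨_, hw.append ht hte, ?_⟩
    have hsd : (s : ℝ) + t ≤ d := by exact_mod_cast hs
    have ht' : (1 : ℝ) ≤ t := by exact_mod_cast ht
    have hs0 : (0 : ℝ) ≤ s := s.cast_nonneg
    have hmin : L * min ((t : ℝ) * α) (((d : ℝ) - s) * β) - d * δ
        ≤ min ((t : ℝ) * α') (((d : ℝ) - s) * β') := by
      have h1 := mul_le_mul_of_nonneg_left (min_le_left ((t : ℝ) * α) (((d : ℝ) - s) * β)) hL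
      have h2 := mul_le_mul_of_nonneg_left (min_le_right ((t : ℝ) * α) (((d : ℝ) - s) * β)) hL
      refine le_min ?_ ?_
      · nlinarith [mul_le_mul_of_nonneg_left hα (by linarith : (0 : ℝ) ≤ t),
          mul_le_mul_of_nonneg_right (by linarith : (t : ℝ) ≤ d) hδ]
      · nlinarith [mul_le_mul_of_nonneg_left hβ (by linarith : (0 : ℝ) ≤ (d : ℝ) - s),
          mul_le_mul_of_nonneg_right (by linarith : (d : ℝ) - s ≤ d) hδ]
    have hdδ : 0 ≤ (d : ℝ) * δ := by positivity
    push_cast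
    nlinarith [mul_le_mul_of_nonneg_right ht' hdδ]

/-! ### Generic vectors over a large finite field -/

section Generic

variable {K V : Type*} [Field K] [AddCommGroup V] [Module K V]

theorem card_mul_ncard_le_of_lt [Finite V] {P X : Submodule K V} (h : P < X) :
    Nat.card K * (P : Set V).ncard ≤ (X : Set V).ncard := by
  obtain ⟨x, -, hx⟩ := SetLike.exists_of_lt h
  have hx0 : x ≠ 0 := fun h0 => hx (h0 ▸ P.zero_mem)
  have : Finite K := Finite.of_injective (fun a : K => a • x) (smul_left_injective K hx0)
  have : FiniteDimensional K V := Module.Finite.of_finite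
  have hlt := Submodule.finrank_lt_finrank_of_lt h
  have hK : 0 < Nat.card K := Nat.card_pos
  have hc (W : Submodule K V) : (W : Set V).ncard = Nat.card K ^ Module.finrank K W := by
    rw [← Module.natCard_eq_pow_finrank (K := K)]; rfl
  rw [hc, hc, ← pow_succ']
  exact Nat.pow_le_pow_right hK hlt

/-- Over a field with more elements than `s`, a subspace `X` has a vector that lies in no member of
`s` except those that contain `X`. -/
theorem exists_mem_forall_mem_imp_le [Finite V] (X : Submodule K V)
    (s : Finset (Submodule K V)) (hs : s.card < Nat.card K) :
    ∃ z ∈ X, ∀ W ∈ s, z ∈ W → X ≤ W := by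
  classical
  by_contra! hcon
  have hcover : (X : Set V) ⊆
      ⋃ W ∈ s.filter (fun W => ¬ X ≤ W), ((X ⊓ W : Submodule K V) : Set V) := by
    intro z hz
    obtain ⟨W, hW, hzW, hXW⟩ := hcon z hz
    simp only [Set.mem_iUnion]
    exact ⟨W, Finset.mem_filter.2 ⟨hW, hXW⟩, hz, hzW⟩
  have hX : 0 < (X : Set V).ncard := (Set.ncard_pos).2 ⟨0, X.zero_mem⟩
  have h1 : (X : Set V).ncard ≤
      ∑ W ∈ s.filter (fun W => ¬ X ≤ W), ((X ⊓ W : Submodule K V) : Set V).ncard :=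
    (Set.ncard_le_ncard hcover).trans (Finset.set_ncard_biUnion_le _ _)
  have h2 : Nat.card K * (X : Set V).ncard ≤ s.card * (X : Set V).ncard := by
    calc Nat.card K * (X : Set V).ncard
        ≤ ∑ W ∈ s.filter (fun W => ¬ X ≤ W),
            Nat.card K * ((X ⊓ W : Submodule K V) : Set V).ncard := by
          rw [← Finset.mul_sum]; exact Nat.mul_le_mul_left _ h1
      _ ≤ ∑ _W ∈ s.filter (fun W => ¬ X ≤ W), (X : Set V).ncard := by
          refine Finset.sum_le_sum fun W hW => card_mul_ncard_le_of_lt ?_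
          exact lt_of_le_of_ne inf_le_left fun h => (Finset.mem_filter.1 hW).2 (inf_eq_left.1 h)
      _ ≤ s.card * (X : Set V).ncard := by
          rw [Finset.sum_const, smul_eq_mul]
          exact Nat.mul_le_mul_right _ (Finset.card_filter_le _ _)
  exact absurd (Nat.le_of_mul_le_mul_right h2 hX) (by omega)

/-- Choosing one generic vector `z j` in each of the subspaces `X j` realizes the largest possible
dimensions: for every `U i` and every set `S` of indices, the span of `U i` and the `z j`, `j ∈ S`,
has dimension at least `dim (U i + ∑ j ∈ R, X j) + |S \ R|` for some `R ⊆ S`. (This is the nontrivial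
half of Rado's rank formula.) -/
theorem exists_generic_vectors [Finite V] {ι J : Type*} [Fintype ι] [Fintype J] [DecidableEq J]
    (U : ι → Submodule K V) (X : J → Submodule K V)
    (hcard : Fintype.card ι * 2 ^ Fintype.card J < Nat.card K) :
    ∃ z : J → V, (∀ j, z j ∈ X j) ∧ ∀ i (S : Finset J), ∃ R ⊆ S,
      Module.finrank K (U i ⊔ R.sup X : Submodule K V) + (S \ R).card ≤
        Module.finrank K (U i ⊔ S.sup fun j => K ∙ z j : Submodule K V) := by
  classical
  have : FiniteDimensional K V := Module.Finite.of_finite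
  -- The subspaces `X j` are replaced by lines one after the other.
  have key : ∀ P : Finset J, ∃ Y : J → Submodule K V,
      (∀ j ∈ P, ∃ z ∈ X j, Y j = K ∙ z) ∧ (∀ j ∉ P, Y j = X j) ∧
      ∀ i (S : Finset J), ∃ R ⊆ S,
        Module.finrank K (U i ⊔ R.sup X : Submodule K V) + (S \ R).card ≤
          Module.finrank K (U i ⊔ S.sup Y : Submodule K V) := by
    intro P
    induction P using Finset.induction_on with
    | empty => exact ⟨X, by simp, by simp, fun i S => ⟨S, subset_rfl, by simp⟩⟩
    | insert p P hp ih =>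
      obtain ⟨Y, hYP, hYX, hY⟩ := ih
      obtain ⟨z, hz, hzW⟩ := exists_mem_forall_mem_imp_le (Y p)
        (Finset.univ.image fun q : ι × Finset J => U q.1 ⊔ q.2.sup Y)
        (lt_of_le_of_lt (Finset.card_image_le.trans (by simp)) hcard)
      have hsup : ∀ S : Finset J, p ∉ S →
          S.sup (Function.update Y p (K ∙ z)) = S.sup Y := fun S hS =>
        Finset.sup_congr rfl fun j hj => by
          rw [Function.update_of_ne]; rintro rfl; exact hS hj
      refine ⟨Function.update Y p (K ∙ z), ?_, ?_, ?_⟩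
      · intro j hj
        by_cases hjp : j = p
        · subst hjp
          exact ⟨z, hYX j hp ▸ hz, by simp⟩
        · rw [Function.update_of_ne hjp]
          exact hYP j ((Finset.mem_insert.1 hj).resolve_left hjp)
      · intro j hj
        rw [Finset.mem_insert, not_or] at hj
        rw [Function.update_of_ne hj.1]
        exact hYX j hj.2
      · intro i S
        by_cases hpS : p ∈ S
        · set S' := S.erase p with hS'
          have hpS' : p ∉ S' := Finset.notMem_erase _ _
          have hins : S = insert p S' := (Finset.insert_erase hpS).symm
          have hupd : U i ⊔ S.sup (Function.update Y p (K ∙ z)) =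
              (U i ⊔ S'.sup Y) ⊔ K ∙ z := by
            rw [hins, Finset.sup_insert, hsup S' hpS', Function.update_self, sup_assoc,
              sup_comm (K ∙ z)]
          rw [hupd]
          by_cases hmem : z ∈ U i ⊔ S'.sup Y
          · have hle : Y p ≤ U i ⊔ S'.sup Y :=
              hzW _ (Finset.mem_image.2 ⟨(i, S'), Finset.mem_univ _, rfl⟩) hmem
            obtain ⟨R, hR, hRle⟩ := hY i S
            refine ⟨R, hR, hRle.trans (Submodule.finrank_mono ?_)⟩
            rw [hins, Finset.sup_insert]
            exact sup_le (le_sup_left.trans le_sup_left)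
              (sup_le (hle.trans le_sup_left) (le_sup_right.trans le_sup_left))
          · obtain ⟨R, hR, hRle⟩ := hY i S'
            have hpR : p ∉ R := fun h => hpS' (hR h)
            refine ⟨R, hR.trans (Finset.erase_subset _ _), ?_⟩
            have hlt : (U i ⊔ S'.sup Y) < (U i ⊔ S'.sup Y) ⊔ K ∙ z := by
              refine lt_of_le_of_ne le_sup_left fun h => hmem ?_
              rw [h]
              exact Submodule.mem_sup_right (Submodule.mem_span_singleton_self z)
            have := Submodule.finrank_lt_finrank_of_lt hlt
            have hc : (S \ R).card = (S' \ R).card + 1 := by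
              rw [hins, Finset.insert_sdiff_of_notMem _ hpR, Finset.card_insert_of_notMem]
              exact fun h => hpS' (Finset.mem_sdiff.1 h).1
            omega
        · rw [hsup S hpS]
          exact hY i S
  obtain ⟨Y, hYz, -, hY⟩ := key Finset.univ
  choose z hz hYz using fun j => hYz j (Finset.mem_univ j)
  obtain rfl : Y = fun j => K ∙ z j := funext hYz
  exact ⟨z, hz, hY⟩

end Generic

/-! ### The cut-set bound -/

section Converse

variable {n : ℕ} {F A B : Type}

theorem Survives.reconstructs {k d e T : ℕ} {c : Fin n → F → A} (h : Survives B k d e T c) :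
    Reconstructs k c := by
  cases T with
  | zero => exact h
  | succ T => exact h.1

/-- The contents of the nodes in `D` are a function of a variable with at most `exp v` values. -/
def DescribedBy (c : Fin n → F → A) (D : Finset (Fin n)) (v : ℝ) : Prop :=
  ∃ (Y : Type) (_ : Fintype Y) (g : F → Y), Real.log (Fintype.card Y) ≤ v ∧
    ∀ x y, g x = g y → ∀ i ∈ D, c i x = c i y

theorem log_card_prod_fun_le {Y I C : Type} [Fintype Y] [Fintype C] [Nonempty Y]
    [Fintype I] [DecidableEq I] {v : ℝ} (hv : Real.log (Fintype.card Y) ≤ v) :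
    Real.log (Fintype.card (Y × (I → C))) ≤ v + Fintype.card I * Real.log (Fintype.card C) := by
  rw [Fintype.card_prod, Fintype.card_fun, Nat.cast_mul, Nat.cast_pow]
  rcases eq_or_ne ((Fintype.card C : ℝ) ^ Fintype.card I) 0 with h | h
  · have h0 := Real.log_natCast_nonneg (Fintype.card Y)
    have h1 := Real.log_natCast_nonneg (Fintype.card C)
    rw [h, mul_zero, Real.log_zero]
    exact add_nonneg (h0.trans hv) (by positivity)
  · rw [Real.log_mul (by exact_mod_cast Fintype.card_ne_zero) h, Real.log_pow]
    linarith

/-- If `D` was described by `v` before a round in which the nodes of `G ⊆ E` fail, and all nodes of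
`D` help, then afterwards the nodes of `G` are described in addition either by their contents or by
the messages of the helpers outside `D`. -/
theorem DescribedBy.repair [Nonempty F] [Fintype A] [Fintype B] {c c' : Fin n → F → A}
    {D E G H : Finset (Fin n)} {v : ℝ} (h : DescribedBy c D v) (hr : IsRepair B E H c c')
    (hDE : Disjoint D E) (hDH : D ⊆ H) (hGE : G ⊆ E) :
    DescribedBy c' (D ∪ G) (v + min ((G.card : ℝ) * Real.log (Fintype.card A))
      (((H.card : ℝ) - (D.card : ℝ)) * Real.log (Fintype.card B))) := by
  obtain ⟨Y, _, g, hv, hg⟩ := h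
  obtain ⟨hsame, send, central, hnew⟩ := hr
  have : Nonempty Y := ⟨g (Classical.arbitrary F)⟩
  have hD : ∀ x y, g x = g y → ∀ i ∈ D, c' i x = c' i y := fun x y hxy i hi => by
    rw [hsame i (Finset.disjoint_left.1 hDE hi)]
    exact hg x y hxy i hi
  rcases min_choice ((G.card : ℝ) * Real.log (Fintype.card A))
    (((H.card : ℝ) - (D.card : ℝ)) * Real.log (Fintype.card B)) with hm | hm
  · refine ⟨Y × (G → A), inferInstance, fun x => (g x, fun i => c' i x), ?_, ?_⟩
    · rw [hm, ← Fintype.card_coe G]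
      exact log_card_prod_fun_le hv
    · intro x y hxy i hi
      rw [Prod.mk.injEq] at hxy
      rcases Finset.mem_union.1 hi with hi | hi
      · exact hD x y hxy.1 i hi
      · exact congrFun hxy.2 ⟨i, hi⟩
  · refine ⟨Y × (↥(H \ D) → B), inferInstance, fun x =>
      (g x, fun i => send ⟨i, (Finset.mem_sdiff.1 i.2).1⟩ (c i x)), ?_, ?_⟩
    · rw [hm, ← Nat.cast_sub (Finset.card_le_card hDH), ← Finset.card_sdiff_of_subset hDH,
        ← Fintype.card_coe (H \ D)]
      exact log_card_prod_fun_le hv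
    · intro x y hxy i hi
      rw [Prod.mk.injEq] at hxy
      rcases Finset.mem_union.1 hi with hi | hi
      · exact hD x y hxy.1 i hi
      · have hmsg : (fun h : H => send h (c h x)) = fun h : H => send h (c h y) := by
          funext h
          by_cases hhD : (h : Fin n) ∈ D
          · rw [hg x y hxy.1 h hhD]
          · exact congrFun hxy.2 ⟨h, Finset.mem_sdiff.2 ⟨h.2, hhD⟩⟩
        have h1 := hnew ⟨i, hGE hi⟩ x
        have h2 := hnew ⟨i, hGE hi⟩ y
        rw [hmsg] at h1
        exact h1.trans h2.symm

/-- An adversary that fails the parts of a composition one after the other, each time with all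
earlier parts among the helpers, reaches a state in which these nodes are described by the value of
the composition. -/
theorem PartialValue.exists_describedBy [Nonempty F] [Fintype A] [Fintype B]
    {k d e T s : ℕ} {v : ℝ} (hkd : k ≤ d) (hdn : d + e ≤ n) (hT : k ≤ T)
    {c : Fin n → F → A} (hc : Survives B k d e T c)
    (h : PartialValue d e (Real.log (Fintype.card A)) (Real.log (Fintype.card B)) s v)
    (hs : s ≤ k) :
    ∃ (T' : ℕ) (c' : Fin n → F → A) (D : Finset (Fin n)), T ≤ T' + s ∧ Survives B k d e T' c' ∧
      D.card = s ∧ DescribedBy c' D v := by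
  induction h with
  | zero => exact ⟨T, c, ∅, le_rfl, hc, rfl, Unit, inferInstance, fun _ => (), by simp, by simp⟩
  | @append s t v _ ht hte ih =>
    obtain ⟨T', c', D, hTs, hc', hD, hdesc⟩ := ih (by omega)
    obtain ⟨T', rfl⟩ : ∃ T'', T' = T'' + 1 := ⟨T' - 1, by omega⟩
    obtain ⟨H, hDH, -, hH⟩ := Finset.exists_subsuperset_card_eq (Finset.subset_univ D)
      (by omega : D.card ≤ d) (by simp; omega)
    obtain ⟨E, hEH, hE⟩ := Finset.exists_subset_card_eq
      (by rw [Finset.card_compl, Fintype.card_fin]; omega : e ≤ Hᶜ.card)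
    obtain ⟨G, hGE, hG⟩ := Finset.exists_subset_card_eq (by omega : t ≤ E.card)
    have hHE : Disjoint H E := Finset.disjoint_left.2 fun i hi hiE =>
      Finset.mem_compl.1 (hEH hiE) hi
    obtain ⟨c'', hr, hc''⟩ := hc'.2 E H hE hH hHE.symm
    refine ⟨T', c'', D ∪ G, by omega, hc'', ?_, ?_⟩
    · rw [Finset.card_union_of_disjoint (hHE.mono hDH hGE), hD, hG]
    · have := hdesc.repair hr (hHE.mono_left hDH) hDH hGE
      rwa [hG, hH, hD] at this

theorem Survives.log_card_le [Fintype F] [Fintype A] [Fintype B]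
    {k d e T : ℕ} {v : ℝ} (hkd : k ≤ d) (hdn : d + e ≤ n) (hT : k ≤ T)
    {c : Fin n → F → A} (hc : Survives B k d e T c)
    (h : PartialValue d e (Real.log (Fintype.card A)) (Real.log (Fintype.card B)) k v)
    [Nonempty F] : Real.log (Fintype.card F) ≤ v := by
  obtain ⟨T', c', D, -, hc', hD, Y, _, g, hv, hg⟩ :=
    h.exists_describedBy hkd hdn hT hc le_rfl
  obtain ⟨decode, hdec⟩ := hc'.reconstructs D hD
  have hinj : Function.Injective g := fun x y hxy => by
    rw [← hdec x, ← hdec y]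
    congr 1
    funext i
    exact hg x y hxy i i.2
  refine (Real.log_le_log ?_ ?_).trans hv
  · exact_mod_cast Fintype.card_pos
  · exact_mod_cast Fintype.card_le_of_injective g hinj

/-- The cut-set bound in an arbitrary unit `r`. An empty `F` is harmless, since then the logarithm
has the junk value `0`. -/
theorem Survives.le_of_log_bounds [Fintype F] [Fintype A] [Fintype B]
    {k d e T : ℕ} {M α β r v : ℝ} (hkd : k ≤ d) (hdn : d + e ≤ n) (hT : k ≤ T)
    (hα : 0 ≤ α) (hβ : 0 ≤ β) (hr : 0 < r)
    (hF : r * M ≤ Real.log (Fintype.card F)) (hA : Real.log (Fintype.card A) ≤ r * α)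
    (hB : Real.log (Fintype.card B) ≤ r * β) {c : Fin n → F → A} (hc : Survives B k d e T c)
    (hv : PartialValue d e α β k v) : M ≤ v := by
  rcases isEmpty_or_nonempty F with hF0 | hF0
  · rw [Fintype.card_eq_zero, Nat.cast_zero, Real.log_zero] at hF
    exact (nonpos_of_mul_nonpos_right hF hr).trans (hv.nonneg hα hβ hkd)
  · obtain ⟨w, hw, hwv⟩ := hv.exists_approx (L := r⁻¹) (δ := 0) (by positivity) le_rfl
      (by rw [sub_zero]; exact (inv_mul_le_iff₀ hr).2 hA)
      (by rw [sub_zero]; exact (inv_mul_le_iff₀ hr).2 hB) hkd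
    rw [mul_zero, mul_zero, sub_zero, inv_mul_le_iff₀ hr] at hwv
    exact le_of_mul_le_mul_left (hF.trans ((hc.log_card_le hkd hdn hT hw).trans hwv)) hr

end Converse

/-! ### Linear codes and their repair -/

section Achievability

variable {K : Type} [Field K] {n M : ℕ}

/-- The linear code whose node `i` stores the products of the file with the vectors `v i a`. -/
def linearCode {α : ℕ} (v : Fin n → Fin α → Fin M → K) : Fin n → (Fin M → K) → (Fin α → K) :=
  fun i x a => v i a ⬝ᵥ x

/-- The space of all linear functions of the file that node `i` can compute. -/
def nodeSpan {α : ℕ} (v : Fin n → Fin α → Fin M → K) (i : Fin n) : Submodule K (Fin M → K) :=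
  Submodule.span K (Set.range (v i))

/-- Any `s ≤ k` nodes store at least `min M f(u)` independent functions of the file, for some
composition `u` of `s` with parts at most `e`, which may depend on the nodes. -/
def RankBound (k d e : ℕ) {α : ℕ} (β : ℕ) (v : Fin n → Fin α → Fin M → K) : Prop :=
  ∀ S : Finset (Fin n), S.card ≤ k → ∃ w : ℝ, PartialValue d e α β S.card w ∧
    min (M : ℝ) w ≤ Module.finrank K (S.sup (nodeSpan v) : Submodule K (Fin M → K))

/-- The vectors `z` whose product does not distinguish the files `x` and `y`. -/
def indistinguishing (x y : Fin M → K) : Submodule K (Fin M → K) where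
  carrier := {z | z ⬝ᵥ x = z ⬝ᵥ y}
  zero_mem' := by simp
  add_mem' {a b} ha hb := by
    rw [Set.mem_ofPred_eq] at ha hb ⊢
    rw [add_dotProduct, add_dotProduct, ha, hb]
  smul_mem' a z hz := by
    rw [Set.mem_ofPred_eq] at hz ⊢
    rw [smul_dotProduct, smul_dotProduct, hz]

theorem nodeSpan_le_indistinguishing {α : ℕ} {v : Fin n → Fin α → Fin M → K} {i : Fin n}
    {x y : Fin M → K} (h : linearCode v i x = linearCode v i y) :
    nodeSpan v i ≤ indistinguishing x y := by
  refine Submodule.span_le.2 ?_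
  rintro _ ⟨a, rfl⟩
  exact congrFun h a

theorem reconstructs_linearCode {k α : ℕ} {v : Fin n → Fin α → Fin M → K}
    (h : ∀ S : Finset (Fin n), S.card = k → S.sup (nodeSpan v) = ⊤) :
    Reconstructs k (linearCode v) := by
  intro S hS
  have hinj : Function.Injective fun (x : Fin M → K) (i : S) => linearCode v i x := by
    intro x y hxy
    have htop : ⊤ ≤ indistinguishing x y := h S hS ▸ Finset.sup_le fun i hi =>
      nodeSpan_le_indistinguishing (congrFun hxy ⟨i, hi⟩)
    funext j
    have hj : Pi.single j 1 ⬝ᵥ x = Pi.single j 1 ⬝ᵥ y := htop Submodule.mem_top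
    simpa using hj
  obtain ⟨decode, hdec⟩ := hinj.hasLeftInverse
  exact ⟨decode, hdec⟩

theorem RankBound.reconstructs {k d e α β : ℕ} {v : Fin n → Fin α → Fin M → K}
    (h : RankBound k d e β v) (hM : ∀ w, PartialValue d e α β k w → (M : ℝ) ≤ w) :
    Reconstructs k (linearCode v) := by
  refine reconstructs_linearCode fun S hS => ?_
  obtain ⟨w, hw, hle⟩ := h S hS.le
  rw [min_eq_left (hM w (hS ▸ hw))] at hle
  refine Submodule.eq_top_of_finrank_eq (le_antisymm (Submodule.finrank_le _) ?_)
  rw [Module.finrank_fin_fun]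
  exact_mod_cast hle

/-- Contents that are spanned by vectors `z h b`, each in the span of the helper `h`, are the result
of a repair. -/
theorem isRepair_linearCode {α β : ℕ} {v v' : Fin n → Fin α → Fin M → K}
    {E H : Finset (Fin n)} {z : Fin n × Fin β → Fin M → K} (hz : ∀ j, z j ∈ nodeSpan v j.1)
    (hsame : ∀ i ∉ E, v' i = v i)
    (hnew : ∀ i ∈ E, ∀ a, v' i a ∈ (H ×ˢ Finset.univ).sup fun j => K ∙ z j) :
    IsRepair (Fin β → K) E H (linearCode v) (linearCode v') := by
  refine ⟨fun i hi => by funext x a; simp only [linearCode, hsame i hi], ?_⟩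
  have hsend : ∀ h : H, ∃ s : (Fin α → K) → (Fin β → K),
      (fun x b => z (h, b) ⬝ᵥ x) = s ∘ linearCode v h := fun h =>
    (Function.factorsThrough_iff _).1 fun x y hxy => funext fun b =>
      nodeSpan_le_indistinguishing hxy (hz (h, b))
  choose send hsend using hsend
  have hfact : Function.FactorsThrough (fun (x : Fin M → K) (i : E) => linearCode v' i x)
      (fun (x : Fin M → K) (h : H) => send h (linearCode v h x)) := by
    intro x y hxy
    have hle : ((H ×ˢ Finset.univ).sup fun j => K ∙ z j) ≤ indistinguishing x y := by
      refine Finset.sup_le fun j hj => (Submodule.span_singleton_le_iff_mem _ _).2 ?_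
      have hh : j.1 ∈ H := (Finset.mem_product.1 hj).1
      have hx := congrFun (congrFun (hsend ⟨j.1, hh⟩) x) j.2
      have hy := congrFun (congrFun (hsend ⟨j.1, hh⟩) y) j.2
      exact hx.trans ((congrFun (congrFun hxy ⟨j.1, hh⟩) j.2).trans hy.symm)
    funext i a
    exact hle (hnew i i.2 a)
  obtain ⟨central, hcentral⟩ := (Function.factorsThrough_iff _).1 hfact
  exact ⟨send, central, fun i x => congrFun (congrFun hcentral x) i⟩

variable [Finite K]

/-- Generic messages of the helpers: outside `S`, they add to the span of `S` what the cut-set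
counts, for the worst set `R` of helpers whose whole content becomes known. -/
theorem exists_generic_messages {α β : ℕ} (v : Fin n → Fin α → Fin M → K)
    (hK : 2 ^ n * 2 ^ (n * β) < Nat.card K) :
    ∃ z : Fin n × Fin β → Fin M → K, (∀ j, z j ∈ nodeSpan v j.1) ∧
      ∀ H S : Finset (Fin n), ∃ R ⊆ H \ S,
        Module.finrank K ((S ∪ R).sup (nodeSpan v) : Submodule K (Fin M → K)) +
          ((H \ S).card - R.card) * β ≤
        Module.finrank K (S.sup (nodeSpan v) ⊔ (H ×ˢ Finset.univ).sup fun j => K ∙ z j :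
          Submodule K (Fin M → K)) := by
  obtain ⟨z, hz, hgen⟩ := exists_generic_vectors
    (fun S : Finset (Fin n) => S.sup (nodeSpan v)) (fun j : Fin n × Fin β => nodeSpan v j.1)
    (by simpa using hK)
  refine ⟨z, hz, fun H S => ?_⟩
  obtain ⟨R, hR, hle⟩ := hgen S ((H \ S) ×ˢ Finset.univ)
  refine ⟨R.image Prod.fst, ?_, ?_⟩
  · intro h hh
    obtain ⟨j, hj, rfl⟩ := Finset.mem_image.1 hh
    exact (Finset.mem_product.1 (hR hj)).1
  · have h1 : (S ∪ R.image Prod.fst).sup (nodeSpan v) ≤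
        S.sup (nodeSpan v) ⊔ R.sup fun j => nodeSpan v j.1 := by
      rw [Finset.sup_union, Finset.sup_image]; rfl
    have h2 : R.card ≤ (R.image Prod.fst).card * β := by
      have : R ⊆ R.image Prod.fst ×ˢ Finset.univ := fun j hj =>
        Finset.mem_product.2 ⟨Finset.mem_image_of_mem _ hj, Finset.mem_univ _⟩
      simpa using Finset.card_le_card this
    have h3 : S.sup (nodeSpan v) ⊔ ((H \ S) ×ˢ Finset.univ).sup (fun j => K ∙ z j) ≤
        S.sup (nodeSpan v) ⊔ (H ×ˢ Finset.univ).sup fun j => K ∙ z j :=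
      sup_le_sup_left (Finset.sup_mono
        (Finset.product_subset_product_left Finset.sdiff_subset)) _
    have h4 := Submodule.finrank_mono h1
    have h5 := Submodule.finrank_mono h3
    rw [Finset.card_sdiff_of_subset hR, Finset.card_product, Finset.card_univ,
      Fintype.card_fin] at hle
    rw [Nat.sub_mul]
    omega

/-- Generic contents chosen in a subspace `Z`: those of the nodes of `G` are independent of the
nodes in `S` as long as `Z` is not exhausted. -/
theorem exists_generic_contents {α : ℕ} (v : Fin n → Fin α → Fin M → K)
    (hK : 2 ^ n * 2 ^ (n * α) < Nat.card K) (Z : Submodule K (Fin M → K)) :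
    ∃ w : Fin n → Fin α → Fin M → K, (∀ i a, w i a ∈ Z) ∧
      ∀ S G : Finset (Fin n),
        Module.finrank K (S.sup (nodeSpan v) : Submodule K (Fin M → K)) + G.card * α ≤
          Module.finrank K (S.sup (nodeSpan v) ⊔ G.sup (nodeSpan w) :
            Submodule K (Fin M → K)) ∨
        Module.finrank K (S.sup (nodeSpan v) ⊔ Z : Submodule K (Fin M → K)) ≤
          Module.finrank K (S.sup (nodeSpan v) ⊔ G.sup (nodeSpan w) :
            Submodule K (Fin M → K)) := by
  obtain ⟨w, hw, hgen⟩ := exists_generic_vectors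
    (fun S : Finset (Fin n) => S.sup (nodeSpan v)) (fun _ : Fin n × Fin α => Z)
    (by simpa using hK)
  refine ⟨fun i a => w (i, a), fun i a => hw _, fun S G => ?_⟩
  obtain ⟨R, hR, hle⟩ := hgen S (G ×ˢ Finset.univ)
  have h1 : (G ×ˢ Finset.univ).sup (fun j => K ∙ w j) ≤ G.sup (nodeSpan fun i a => w (i, a)) := by
    refine Finset.sup_le fun j hj => ?_
    refine le_trans ?_ (Finset.le_sup (Finset.mem_product.1 hj).1)
    exact Submodule.span_mono (Set.singleton_subset_iff.2 ⟨j.2, rfl⟩)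
  have h2 := Submodule.finrank_mono (sup_le_sup_left h1 (S.sup (nodeSpan v)))
  rcases R.eq_empty_or_nonempty with rfl | ⟨j, hj⟩
  · left
    have h3 := Submodule.finrank_mono (le_sup_left :
      S.sup (nodeSpan v) ≤ S.sup (nodeSpan v) ⊔ (∅ : Finset (Fin n × Fin α)).sup fun _ => Z)
    rw [Finset.sdiff_empty, Finset.card_product, Finset.card_univ, Fintype.card_fin] at hle
    omega
  · right
    have h3 : S.sup (nodeSpan v) ⊔ Z ≤ S.sup (nodeSpan v) ⊔ R.sup fun _ => Z :=
      sup_le_sup_left (Finset.le_sup (f := fun _ => Z) hj) _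
    have := Submodule.finrank_mono h3
    omega

theorem exists_rankBound {k d e α : ℕ} (β : ℕ) (he : 1 ≤ e) (hK : 2 ^ n * 2 ^ (n * α) < Nat.card K) :
    ∃ v : Fin n → Fin α → Fin M → K, RankBound k d e β v := by
  obtain ⟨v, -, hv⟩ := exists_generic_contents (0 : Fin n → Fin α → Fin M → K) hK ⊤
  refine ⟨v, fun S _ => ?_⟩
  obtain ⟨w, hw⟩ := exists_partialValue (d := d) he (α : ℝ) (β : ℝ) S.card
  refine ⟨w, hw, ?_⟩
  rcases hv ∅ S with hle | hle
  · rw [Finset.sup_empty, finrank_bot, zero_add, bot_sup_eq] at hle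
    exact (min_le_right _ _).trans (hw.le_mul.trans (by exact_mod_cast hle))
  · rw [Finset.sup_empty, bot_sup_eq, bot_sup_eq, finrank_top, Module.finrank_fin_fun] at hle
    exact (min_le_left _ _).trans (by exact_mod_cast hle)

theorem RankBound.exists_repair {k d e α β : ℕ} {v : Fin n → Fin α → Fin M → K}
    (h : RankBound k d e β v) (hkd : k ≤ d) (hα : 2 ^ n * 2 ^ (n * α) < Nat.card K)
    (hβ : 2 ^ n * 2 ^ (n * β) < Nat.card K) {E H : Finset (Fin n)} (hE : E.card = e)
    (hH : H.card = d) :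
    ∃ v' : Fin n → Fin α → Fin M → K,
      IsRepair (Fin β → K) E H (linearCode v) (linearCode v') ∧ RankBound k d e β v' := by
  obtain ⟨z, hz, hgenz⟩ := exists_generic_messages v hβ
  obtain ⟨w, hw, hgenw⟩ := exists_generic_contents v hα
    ((H ×ˢ Finset.univ).sup fun j => K ∙ z j)
  classical
  refine ⟨fun i => if i ∈ E then w i else v i, isRepair_linearCode hz
    (fun i hi => if_neg hi) (fun i hi a => by rw [if_pos hi]; exact hw i a), fun S hS => ?_⟩
  set v' : Fin n → Fin α → Fin M → K := fun i => if i ∈ E then w i else v i with hv'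
  have hsup : S.sup (nodeSpan v') = (S \ E).sup (nodeSpan v) ⊔ (S ∩ E).sup (nodeSpan w) := by
    rw [← Finset.sdiff_union_inter S E, Finset.sup_union, Finset.sdiff_union_inter]
    congr 1
    · refine Finset.sup_congr rfl fun i hi => ?_
      simp [nodeSpan, hv', (Finset.mem_sdiff.1 hi).2]
    · refine Finset.sup_congr rfl fun i hi => ?_
      simp [nodeSpan, hv', (Finset.mem_inter.1 hi).2]
  have hcard : (S \ E).card + (S ∩ E).card = S.card := Finset.card_sdiff_add_card_inter S E
  have hte : (S ∩ E).card ≤ e := hE ▸ Finset.card_le_card Finset.inter_subset_right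
  rw [hsup]
  rcases Nat.eq_zero_or_pos (S ∩ E).card with ht | ht
  · obtain ⟨x, hx, hxle⟩ := h (S \ E) (by omega)
    rw [Finset.card_eq_zero.1 ht, Finset.sup_empty, sup_bot_eq]
    exact ⟨x, by rwa [← hcard, ht], hxle⟩
  specialize hgenw (S \ E) (S ∩ E)
  generalize Module.finrank K ((S \ E).sup (nodeSpan v) ⊔ (S ∩ E).sup (nodeSpan w) :
    Submodule K (Fin M → K)) = N at hgenw ⊢
  rcases hgenw with hle | hle
  · -- All new contents are independent: the part `S ∩ E` contributes `|S ∩ E| α`.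
    obtain ⟨x, hx, hxle⟩ := h (S \ E) (by omega)
    refine ⟨_, hcard ▸ hx.append ht hte, ?_⟩
    have hle' : (Module.finrank K ((S \ E).sup (nodeSpan v) : Submodule K (Fin M → K)) : ℝ) +
        (S ∩ E).card * α ≤ N := by exact_mod_cast hle
    refine le_trans ?_ hle'
    have hm := min_le_left (((S ∩ E).card : ℝ) * α) (((d : ℝ) - ((S \ E).card : ℝ)) * β)
    have hnn : (0 : ℝ) ≤ ((S ∩ E).card : ℝ) * α := by positivity
    rcases min_le_iff.1 hxle with hx' | hx'
    · exact (min_le_left _ _).trans (by linarith)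
    · exact (min_le_right _ _).trans (by linarith)
  · -- The span of the messages is exhausted: the helpers in `R` act as further members of `S`.
    obtain ⟨R, hR, hRle⟩ := hgenz H (S \ E)
    have hdisj : Disjoint (S \ E) R := Finset.disjoint_left.2 fun i hi hiR =>
      (Finset.mem_sdiff.1 (hR hiR)).2 hi
    have hcu : ((S \ E) ∪ R).card = (S \ E).card + R.card := Finset.card_union_of_disjoint hdisj
    by_cases hlt : R.card < (S ∩ E).card
    · obtain ⟨x, hx, hxle⟩ := h ((S \ E) ∪ R) (by omega)
      rw [hcu] at hx
      have hxa := hx.append (t := (S ∩ E).card - R.card) (by omega) (by omega)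
      have hsum : (S \ E).card + R.card + ((S ∩ E).card - R.card) = S.card := by omega
      rw [hsum] at hxa
      refine ⟨_, hxa, ?_⟩
      have hHS : d - (S \ E).card ≤ (H \ (S \ E)).card := hH ▸ Finset.le_card_sdiff _ _
      have hle' := (Nat.add_le_add_left (Nat.mul_le_mul_right β (Nat.sub_le_sub_right hHS R.card))
        _).trans (hRle.trans hle)
      rw [Nat.sub_sub] at hle'
      have hle'' : (Module.finrank K (((S \ E) ∪ R).sup (nodeSpan v) :
          Submodule K (Fin M → K)) : ℝ) +
          ((d : ℝ) - (((S \ E).card + R.card : ℕ) : ℝ)) * β ≤ N := by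
        rw [← Nat.cast_sub (by omega)]
        exact_mod_cast hle'
      refine le_trans ?_ hle''
      have hm := min_le_right ((((S ∩ E).card - R.card : ℕ) : ℝ) * α)
        (((d : ℝ) - (((S \ E).card + R.card : ℕ) : ℝ)) * β)
      have hnn : (0 : ℝ) ≤ ((d : ℝ) - (((S \ E).card + R.card : ℕ) : ℝ)) * β := by
        rw [← Nat.cast_sub (by omega)]
        positivity
      rcases min_le_iff.1 hxle with hx' | hx'
      · exact (min_le_left _ _).trans (by linarith)
      · exact (min_le_right _ _).trans (by linarith)
    · obtain ⟨S', hS', hS'c⟩ := Finset.exists_subset_card_eq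
        (by omega : S.card ≤ ((S \ E) ∪ R).card)
      obtain ⟨x, hx, hxle⟩ := h S' (by omega)
      refine ⟨x, hS'c ▸ hx, hxle.trans ?_⟩
      have h1 := Submodule.finrank_mono (Finset.sup_mono (f := nodeSpan v) hS')
      have h2 := h1.trans ((Nat.le_add_right _ _).trans (hRle.trans hle))
      exact_mod_cast h2

theorem RankBound.survives {k d e α β : ℕ} (hkd : k ≤ d)
    (hα : 2 ^ n * 2 ^ (n * α) < Nat.card K) (hβ : 2 ^ n * 2 ^ (n * β) < Nat.card K)
    (hM : ∀ w, PartialValue d e α β k w → (M : ℝ) ≤ w) (T : ℕ)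
    {v : Fin n → Fin α → Fin M → K} (h : RankBound k d e β v) :
    Survives (Fin β → K) k d e T (linearCode v) := by
  induction T generalizing v with
  | zero => exact h.reconstructs hM
  | succ T ih =>
    refine ⟨h.reconstructs hM, fun E H hE hH _ => ?_⟩
    obtain ⟨v', hr, hv'⟩ := h.exists_repair hkd hα hβ hE hH
    exact ⟨_, hr, ih hv'⟩

end Achievability

theorem codesExist_of_le {M n k d e α β T : ℕ} (he : 1 ≤ e) (hkd : k ≤ d)
    (hM : ∀ w, PartialValue d e α β k w → (M : ℝ) ≤ w) : CodesExist M n k d e α β T := by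
  obtain ⟨p, hp, hprime⟩ := Nat.exists_infinite_primes
    (2 ^ n * 2 ^ (n * α) + 2 ^ n * 2 ^ (n * β) + 1)
  have : Fact p.Prime := ⟨hprime⟩
  have hα : 2 ^ n * 2 ^ (n * α) < Nat.card (ZMod p) := by rw [Nat.card_zmod]; omega
  have hβ : 2 ^ n * 2 ^ (n * β) < Nat.card (ZMod p) := by rw [Nat.card_zmod]; omega
  obtain ⟨v, hv⟩ := exists_rankBound (M := M) (k := k) (d := d) (e := e) β he hα
  exact ⟨ZMod p, inferInstance, inferInstance, linearCode v, hv.survives hkd hα hβ hM T⟩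

/-! ### Real parameters -/

theorem codesExistReal_of_le {n k d e T : ℕ} {M α β : ℝ} (he : 1 ≤ e) (hkd : k ≤ d)
    (hα : 0 ≤ α) (hβ : 0 ≤ β) (hM : ∀ w, PartialValue d e α β k w → M ≤ w) :
    CodesExistReal M n k d e α β T := by
  intro ε hε
  -- Rounding to whole symbols costs at most `k * d + 1` symbols of the file.
  set L : ℝ := (k * d + 1) / ε with hLdef
  have hL : 0 < L := by positivity
  have hLε : L * ε = k * d + 1 := div_mul_cancel₀ _ hε.ne'
  obtain ⟨Q, _, _, c, hc⟩ : CodesExist ⌊L * M - k * d⌋₊ n k d e ⌊L * α⌋₊ ⌊L * β⌋₊ T := by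
    refine codesExist_of_le he hkd fun v hv => ?_
    obtain ⟨w, hw, hwv⟩ := hv.exists_approx (α := α) (β := β) (L := L) (δ := 1) hL.le zero_le_one
      (Nat.sub_one_lt_floor _).le (Nat.sub_one_lt_floor _).le hkd
    rw [mul_one] at hwv
    rcases le_total 0 (L * M - k * d) with h0 | h0
    · exact (Nat.floor_le h0).trans
        ((sub_le_sub_right (mul_le_mul_of_nonneg_left (hM w hw) hL.le) _).trans hwv)
    · rw [Nat.floor_of_nonpos h0, Nat.cast_zero]
      exact hv.nonneg (Nat.cast_nonneg _) (Nat.cast_nonneg _) hkd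
  have hQ : 0 < Real.log (Fintype.card Q) :=
    Real.log_pos (by exact_mod_cast Fintype.one_lt_card)
  have hcard (m : ℕ) : Real.log (Fintype.card (Fin m → Q)) = m * Real.log (Fintype.card Q) := by
    rw [Fintype.card_fun, Fintype.card_fin, Nat.cast_pow, Real.log_pow]
  classical
  refine ⟨_, _, _, inferInstance, inferInstance, inferInstance, L * Real.log (Fintype.card Q),
    mul_pos hL hQ, ?_, ?_, ?_, c, hc⟩
  · rw [hcard, mul_right_comm]
    refine mul_le_mul_of_nonneg_right ?_ hQ.le
    have := Nat.sub_one_lt_floor (L * M - k * d)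
    linarith
  · rw [hcard, mul_right_comm]
    exact mul_le_mul_of_nonneg_right (Nat.floor_le (by positivity)) hQ.le
  · rw [hcard, mul_right_comm]
    exact mul_le_mul_of_nonneg_right (Nat.floor_le (by positivity)) hQ.le

end CentralizedRepair

theorem theorem1 (n k d e T : ℕ) (hk : 1 ≤ k) (he : 1 ≤ e) (hkd : k ≤ d) (hdn : d + e ≤ n)
    (hT : k ≤ T) :
    (∀ M α β : ℕ,
      CentralizedRepair.CodesExist M n k d e α β T ↔
        (M : ℝ) ≤ CentralizedRepair.minScenarioValue k d he (α : ℝ) (β : ℝ)) ∧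
    (∀ M α β : ℝ, 0 ≤ M → 0 ≤ α → 0 ≤ β →
      (CentralizedRepair.CodesExistReal M n k d e α β T ↔
        M ≤ CentralizedRepair.minScenarioValue k d he α β)) := by
  refine ⟨fun M α β => ?_, fun M α β _ hα hβ => ?_⟩
  · rw [CentralizedRepair.le_minScenarioValue_iff]
    refine ⟨?_, CentralizedRepair.codesExist_of_le he hkd⟩
    rintro ⟨Q, _, _, c, hc⟩ v hv
    classical
    -- In units of `log |Q|` the sizes of files, contents and messages are exactly `M`, `α` and `β`.
    have hcard (m : ℕ) : Real.log (Fintype.card (Fin m → Q)) =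
        Real.log (Fintype.card Q) * m := by
      rw [Fintype.card_fun, Fintype.card_fin, Nat.cast_pow, Real.log_pow, mul_comm]
    exact hc.le_of_log_bounds hkd hdn hT α.cast_nonneg β.cast_nonneg
      (Real.log_pos (by exact_mod_cast Fintype.one_lt_card))
      (hcard M).ge (hcard α).le (hcard β).le hv
  · rw [CentralizedRepair.le_minScenarioValue_iff]
    refine ⟨fun h v hv => le_of_forall_pos_sub_le fun ε hε => ?_,
      CentralizedRepair.codesExistReal_of_le he hkd hα hβ⟩
    obtain ⟨F, A, B, _, _, _, r, hr, hF, hA, hB, c, hc⟩ := h ε hε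
    exact hc.le_of_log_bounds hkd hdn hT hα hβ hr hF hA hB hv
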